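/- Let $M,N\ge 0$ be integers with $M+N\ge 1$, and let $X_1,\dots,X_M,Y_1,\dots,Y_N$ be independent random variables with $X_i\sim N(0,\sigma_{X_i}^2)$ and $Y_j\sim N(0,\sigma_{Y_j}^2)$, where all $\sigma_{X_i},\sigma_{Y_j}>0$. Put $\sigma_M=\sigma_{X_1}\cdots\sigma_{X_M}$, $s_N=\sigma_{Y_1}\cdots\sigma_{Y_N}$ and $Z=X_1\cdots X_M/(Y_1\cdots Y_N)$, where empty products are $1$. For $x>0$ let $$G^{M,N}_{N,M}\left(x\,\middle|\,{0,\ldots,0\atop 0,\ldots,0}\right)=\frac1{2\pi \mathrm{i}}\int_L \Gamma(-s)^M\,\Gamma(1+s)^N\,x^s\,\mathrm{d}s$$ be the Meijer $G$-function, where $L$ is a vertical line, directed upwards, that has all poles of $\Gamma(-s)^M$ on its right and all poles of $\Gamma(1+s)^N$ on its left; such lines exist, the integral converges absolutely along each of them, and its value does not depend on the line. Then the distribution of $Z$ has a density $f_Z:\mathbb{R}\to[0,\infty]$ with respect to Lebesgue measure that is continuous as a map into $[0,\infty]$, and for every real $z\ne 0$ the value $f_Z(z)$ is finite and $$f_Z(z)=\frac{2^{(N-M)/2}s_N}{\pi^{(M+N)/2}\sigma_M}\,G^{M,N}_{N,M}\left(\frac{2^Ns_N^2}{2^M\sigma_M^2}z^2\,\middle|\,{0,\ldots,0\atop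 0,\ldots,0}\right).$$ By continuity the formula also holds at $z=0$ when its right-hand side is read there as the limit in $[0,\infty]$ for $z\to0$. -/

import Mathlib

open MeasureTheory ProbabilityTheory
open scoped ENNReal

/-- The integrand
`∏_{j≤m} Γ(b_j - s) ∏_{j≤n} Γ(1 - a_j + s) / (∏_{n<j≤p} Γ(a_j - s) ∏_{m<j≤q} Γ(1 - b_j + s)) · x^s`
of the Meijer `G`-function `G^{m,n}_{p,q}(x | a_1,…,a_p; b_1,…,b_q)`
(indices are shifted: `j : Fin p` with `j < n` is the `(j+1)`-st parameter).
A Gamma factor of the denominator that has a pole contributes `0`, in accordance with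
`1 / Γ` being entire. -/
noncomputable def meijerIntegrand {p q : ℕ} (m n : ℕ) (a : Fin p → ℂ) (b : Fin q → ℂ)
    (x : ℝ) (s : ℂ) : ℂ :=
  ((∏ j : Fin q with j.val < m, Complex.Gamma (b j - s)) *
      ∏ j : Fin p with j.val < n, Complex.Gamma (1 - a j + s)) /
    ((∏ j : Fin p with n ≤ j.val, Complex.Gamma (a j - s)) *
      ∏ j : Fin q with m ≤ j.val, Complex.Gamma (1 - b j + s)) * (x : ℂ) ^ s

/-- The vertical line `Re s = c` separates the poles `b_j + k` of the factors `Γ(b_j - s)`, `j ≤ m`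
(which lie to its right), from the poles `a_j - 1 - k` of the factors `Γ(1 - a_j + s)`, `j ≤ n`
(which lie to its left). -/
def SeparatesPoles {p q : ℕ} (m n : ℕ) (a : Fin p → ℂ) (b : Fin q → ℂ) (c : ℝ) : Prop :=
  (∀ j : Fin q, j.val < m → ∀ k : ℕ, c < (b j + k).re) ∧
    ∀ j : Fin p, j.val < n → ∀ k : ℕ, (a j - 1 - k).re < c

/-- `(2πi)⁻¹ ∫_L … ds` along the line `L = {c + it}` from `c - i∞` to `c + i∞`, `ds = i dt`. -/
noncomputable def meijerLineIntegral {p q : ℕ} (m n : ℕ) (a : Fin p → ℂ) (b : Fin q → ℂ)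
    (x : ℝ) (c : ℝ) : ℂ :=
  (2 * Real.pi * Complex.I)⁻¹ *
    ∫ t : ℝ, meijerIntegrand m n a b x (c + t * Complex.I) * Complex.I

open Classical in
/-- The Meijer `G`-function `G^{m,n}_{p,q}(x | a; b)` of `x > 0`, for parameters whose two families
of poles can be separated by a vertical line: the Mellin–Barnes integral along such a line.
That the integral converges and does not depend on the line is the content of
`MeijerGWellDefined`. -/
noncomputable def meijerG {p q : ℕ} (m n : ℕ) (a : Fin p → ℂ) (b : Fin q → ℂ) (x : ℝ) : ℂ :=
  if h : ∃ c : ℝ, SeparatesPoles m n a b c then meijerLineIntegral m n a b x h.choose else 0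

/-- There is a separating vertical line, and along every one of them the integral that defines
`G^{m,n}_{p,q}(x | a; b)` converges absolutely and has the same value `meijerG m n a b x`. -/
def MeijerGWellDefined {p q : ℕ} (m n : ℕ) (a : Fin p → ℂ) (b : Fin q → ℂ) (x : ℝ) : Prop :=
  (∃ c : ℝ, SeparatesPoles m n a b c) ∧
    ∀ c : ℝ, SeparatesPoles m n a b c →
      Integrable (fun t : ℝ => meijerIntegrand m n a b x (c + t * Complex.I)) ∧
        meijerLineIntegral m n a b x c = meijerG m n a b x

/-! For an even density f of Z, the moment E|Z|^(w-1) is twice the Mellin transform of f on the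
half-line at w. Independence factors this moment into Gaussian absolute moments, each of them a
Gamma value (`integral_abs_cpow_gaussianReal`). With w = 2v the product is a constant times A^(2v-1)
Γ(v)^M Γ(1-v)^N, where A collects the scales (`integral_abs_quotient_cpow`). Since Γ decays at least
quadratically on vertical lines in the right half-plane, Mellin inversion
(`mellin_inversion_scaled`) recovers f at positive points as an absolutely convergent integral over
Re v = c, and s = -v turns it into the Meijer integral.

Inversion is pointwise only where f is continuous, so a continuous version is built first
(`exists_even_continuous_density`). If there is a numerator factor, conditioning on all other
variables exhibits f as a mixture of centred Gaussian densities; otherwise Z is the reciprocal of a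
variable of that kind. Inversion returns the same f(z) on every admissible line, so independence of
the line needs no contour shift (`meijerGWellDefined_of_lineIntegral_eq`). -/

/-! ### Complex absolute moments of centred Gaussians and of their products -/

theorem mellinConvergent_exp_neg_sq {a : ℝ} (ha : 0 < a) {s : ℂ} (hs : 0 < s.re) :
    MellinConvergent (fun t : ℝ => ((Real.exp (-(a⁻¹ * t) ^ (2 : ℝ)) : ℝ) : ℂ)) s := by
  rw [MellinConvergent.comp_mul_left
    (f := fun t : ℝ => ((Real.exp (-t ^ (2 : ℝ)) : ℝ) : ℂ)) (inv_pos.2 ha),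
    MellinConvergent.comp_rpow (f := fun t : ℝ => ((Real.exp (-t) : ℝ) : ℂ)) two_ne_zero]
  have := Complex.GammaIntegral_convergent (s := s / 2) (by simpa using hs)
  refine this.congr (.of_forall fun t => ?_)
  simp [mul_comm]

theorem mellin_exp_neg_sq {a : ℝ} (ha : 0 < a) {s : ℂ} (hs : 0 < s.re) :
    mellin (fun t : ℝ => ((Real.exp (-(a⁻¹ * t) ^ (2 : ℝ)) : ℝ) : ℂ)) s =
      (a : ℂ) ^ s * Complex.Gamma (s / 2) / 2 := by
  rw [mellin_comp_mul_left
    (f := fun t : ℝ => ((Real.exp (-t ^ (2 : ℝ)) : ℝ) : ℂ)) _ (inv_pos.2 ha),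
    mellin_comp_rpow (f := fun t : ℝ => ((Real.exp (-t) : ℝ) : ℂ)),
    ← Complex.GammaIntegral_eq_mellin, Complex.Gamma_eq_integral (by simpa using hs)]
  have : ((a⁻¹ : ℝ) : ℂ) ^ (-s) = (a : ℂ) ^ s := by
    rw [Complex.ofReal_inv, Complex.inv_cpow, Complex.cpow_neg, inv_inv]
    rw [Complex.arg_ofReal_of_nonneg ha.le]
    exact Real.pi_pos.ne
  rw [this]
  simp
  ring

/-- Written through |x| and a real power 2, the density fits both the folding of even integrals onto
the half-line and the Mellin rules for dilations and powers. -/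
theorem gaussianPDFReal_zero_sq {σ : ℝ} (hσ : 0 < σ) (x : ℝ) :
    gaussianPDFReal 0 (σ ^ 2).toNNReal x =
      (√Real.pi * (√2 * σ))⁻¹ * Real.exp (-((√2 * σ)⁻¹ * |x|) ^ (2 : ℝ)) := by
  rw [gaussianPDFReal, Real.coe_toNNReal _ (sq_nonneg σ), Real.rpow_two, mul_pow, sq_abs, inv_pow,
    mul_pow, Real.sq_sqrt zero_le_two, Real.sqrt_mul (by positivity), Real.sqrt_sq hσ.le,
    Real.sqrt_mul (by positivity)]
  congr 2
  · ring
  · rw [sub_zero]; ring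

theorem toNNReal_sq_ne_zero {σ : ℝ} (hσ : 0 < σ) : (σ ^ 2).toNNReal ≠ 0 := by
  simpa using by positivity

theorem integrable_gaussianReal_iff {σ : ℝ} (hσ : 0 < σ) (g : ℝ → ℂ) :
    Integrable g (gaussianReal 0 (σ ^ 2).toNNReal) ↔
      Integrable fun x => gaussianPDFReal 0 (σ ^ 2).toNNReal x • g x := by
  rw [gaussianReal_of_var_ne_zero _ (toNNReal_sq_ne_zero hσ),
    integrable_withDensity_iff_integrable_smul' (measurable_gaussianPDF _ _)
      (.of_forall fun _ => gaussianPDF_lt_top)]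
  simp

theorem integrable_comp_abs_iff {E : Type*} [NormedAddCommGroup E] (g : ℝ → E) :
    Integrable (fun x => g |x|) ↔ IntegrableOn g (Set.Ioi 0) := by
  have hpos : IntegrableOn (fun x => g |x|) (Set.Ioi 0) ↔ IntegrableOn g (Set.Ioi 0) :=
    integrableOn_congr_fun (fun x hx => by simp [abs_of_pos (Set.mem_Ioi.1 hx)]) measurableSet_Ioi
  refine ⟨fun h => hpos.1 h.integrableOn, fun h => ?_⟩
  have hneg : IntegrableOn (fun x => g |x|) (Set.Iic 0) := by
    rw [← Measure.map_neg_eq_self (volume : Measure ℝ)]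
    let m : MeasurableEmbedding fun x : ℝ => -x := (Homeomorph.neg ℝ).measurableEmbedding
    rw [m.integrableOn_map_iff]
    simp_rw [Function.comp_def, abs_neg, Set.neg_preimage, Set.neg_Iic, neg_zero]
    exact Iff.mpr integrableOn_Ici_iff_integrableOn_Ioi (hpos.2 h)
  rw [← integrableOn_univ, ← Set.Iic_union_Ioi (a := (0 : ℝ))]
  exact hneg.union (hpos.2 h)

theorem integral_comp_abs_eq_two_smul {E : Type*} [NormedAddCommGroup E] [NormedSpace ℝ E]
    {g : ℝ → E} (hg : IntegrableOn g (Set.Ioi 0)) :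
    ∫ x, g |x| = (2 : ℝ) • ∫ x in Set.Ioi (0 : ℝ), g x := by
  have hi := (integrable_comp_abs_iff g).2 hg
  have eq : ∫ x in Set.Ioi (0 : ℝ), g |x| = ∫ x in Set.Ioi (0 : ℝ), g x :=
    setIntegral_congr_fun measurableSet_Ioi fun x hx => by simp [abs_of_pos (Set.mem_Ioi.1 hx)]
  have eq' : ∫ x in Set.Iic (0 : ℝ), g |x| = ∫ x in Set.Ioi (0 : ℝ), g x := by
    rw [← neg_zero, ← integral_comp_neg_Iic, neg_zero]
    exact setIntegral_congr_fun measurableSet_Iic fun x hx => by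
      simp [abs_of_nonpos (Set.mem_Iic.1 hx)]
  rw [← intervalIntegral.integral_Iic_add_Ioi hi.integrableOn hi.integrableOn (b := 0), eq, eq',
    two_smul]

theorem integrable_abs_cpow_gaussianReal {σ : ℝ} (hσ : 0 < σ) {r : ℂ} (hr : -1 < r.re) :
    Integrable (fun x : ℝ => ((|x| : ℝ) : ℂ) ^ r) (gaussianReal 0 (σ ^ 2).toNNReal) := by
  rw [integrable_gaussianReal_iff hσ]
  have h := mellinConvergent_exp_neg_sq (a := √2 * σ) (by positivity) (s := r + 1)
    (by simp; linarith)
  rw [MellinConvergent, ← integrable_comp_abs_iff] at h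
  refine (h.const_mul (((√Real.pi * (√2 * σ))⁻¹ : ℝ) : ℂ)).congr (.of_forall fun x => ?_)
  simp only [gaussianPDFReal_zero_sq hσ, Complex.real_smul, smul_eq_mul, add_sub_cancel_right,
    Complex.ofReal_mul]
  ring

theorem integral_abs_cpow_gaussianReal {σ : ℝ} (hσ : 0 < σ) {r : ℂ} (hr : -1 < r.re) :
    ∫ x : ℝ, ((|x| : ℝ) : ℂ) ^ r ∂gaussianReal 0 (σ ^ 2).toNNReal =
      (√Real.pi : ℂ)⁻¹ * ((√2 * σ : ℝ) : ℂ) ^ r * Complex.Gamma ((r + 1) / 2) := by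
  have ha : 0 < √2 * σ := by positivity
  have h := mellin_exp_neg_sq ha (s := r + 1) (by simp; linarith)
  rw [integral_gaussianReal_eq_integral_smul (toNNReal_sq_ne_zero hσ)]
  have h2 := integral_comp_abs_eq_two_smul
    (mellinConvergent_exp_neg_sq ha (s := r + 1) (by simp; linarith))
  rw [← mellin, h] at h2
  trans (((√Real.pi * (√2 * σ))⁻¹ : ℝ) : ℂ) * ∫ x : ℝ, ((|x| : ℝ) : ℂ) ^ (r + 1 - 1) •
    ((Real.exp (-((√2 * σ)⁻¹ * |x|) ^ (2 : ℝ)) : ℝ) : ℂ)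
  · rw [← integral_const_mul]
    congr 1 with x
    simp only [gaussianPDFReal_zero_sq hσ, Complex.real_smul, smul_eq_mul, add_sub_cancel_right,
      Complex.ofReal_mul]
    ring
  · rw [h2, Complex.cpow_add _ _ (by exact_mod_cast ha.ne'), Complex.cpow_one]
    have : ((√2 * σ : ℝ) : ℂ) ≠ 0 := by exact_mod_cast ha.ne'
    rw [Complex.ofReal_inv, Complex.ofReal_mul √Real.pi, Complex.real_smul, Complex.ofReal_ofNat]
    field_simp

theorem integrable_prod_abs_cpow {Ω ι : Type*} [Fintype ι] [MeasurableSpace Ω] {P : Measure Ω}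
    {U : ι → Ω → ℝ} {σ : ι → ℝ} (hσ : ∀ i, 0 < σ i)
    (hU : ∀ i, HasLaw (U i) (gaussianReal 0 (σ i ^ 2).toNNReal) P) (hind : iIndepFun U P)
    {r : ι → ℂ} (hr : ∀ i, -1 < (r i).re) :
    Integrable (fun ω => ∏ i, ((|U i ω| : ℝ) : ℂ) ^ r i) P := by
  have hlaw := hind.hasLaw_pi hU
  have h := Integrable.fintype_prod (f := fun i (x : ℝ) => ((|x| : ℝ) : ℂ) ^ r i)
    (fun i => integrable_abs_cpow_gaussianReal (hσ i) (hr i))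
  rw [← hlaw.map_eq] at h
  exact h.comp_aemeasurable hlaw.aemeasurable

theorem integral_prod_abs_cpow {Ω ι : Type*} [Fintype ι] [MeasurableSpace Ω] {P : Measure Ω}
    {U : ι → Ω → ℝ} {σ : ι → ℝ} (hσ : ∀ i, 0 < σ i)
    (hU : ∀ i, HasLaw (U i) (gaussianReal 0 (σ i ^ 2).toNNReal) P) (hind : iIndepFun U P)
    {r : ι → ℂ} (hr : ∀ i, -1 < (r i).re) :
    ∫ ω, ∏ i, ((|U i ω| : ℝ) : ℂ) ^ r i ∂P =
      ∏ i, ((√Real.pi : ℂ)⁻¹ * ((√2 * σ i : ℝ) : ℂ) ^ r i * Complex.Gamma ((r i + 1) / 2)) := by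
  have hlaw := hind.hasLaw_pi hU
  have h := Integrable.fintype_prod (f := fun i (x : ℝ) => ((|x| : ℝ) : ℂ) ^ r i)
    (fun i => integrable_abs_cpow_gaussianReal (hσ i) (hr i))
  rw [← Finset.prod_congr rfl fun i _ => integral_abs_cpow_gaussianReal (hσ i) (hr i),
    ← integral_fintype_prod_eq_prod]
  exact hlaw.integral_comp h.aestronglyMeasurable

/-! ### Decay of Gamma on vertical lines -/

theorem norm_Gamma_le {s : ℂ} (hs : 0 < s.re) : ‖Complex.Gamma s‖ ≤ Real.Gamma s.re := by
  rw [Complex.Gamma_eq_integral hs, Real.Gamma_eq_integral hs, Complex.GammaIntegral]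
  refine (norm_integral_le_integral_norm _).trans_eq
    (setIntegral_congr_fun measurableSet_Ioi fun x hx => ?_)
  simp [Complex.norm_cpow_eq_rpow_re_of_pos hx, Complex.norm_exp]

/-- Two steps of the functional equation give Γ(s+2) = (s+1) s Γ(s); the left side is at most Γ(c+2)
in norm, and |s+1| ≥ |s|. -/
theorem norm_Gamma_le_inv_sq {c : ℝ} (hc : 0 < c) (t : ℝ) :
    ‖Complex.Gamma (c + t * Complex.I)‖ ≤ Real.Gamma (c + 2) * (c ^ 2 + t ^ 2)⁻¹ := by
  set s : ℂ := c + t * Complex.I with hs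
  have hre : s.re = c := by simp [hs]
  have him : s.im = t := by simp [hs]
  have hs0 : s ≠ 0 := fun h => hc.ne' (by rw [← hre, h]; simp)
  have hs1 : s + 1 ≠ 0 := fun h => by
    have := congrArg Complex.re h
    simp [hre] at this; linarith
  have e : Complex.Gamma (s + 2) = (s + 1) * (s * Complex.Gamma s) := by
    rw [← Complex.Gamma_add_one s hs0, ← Complex.Gamma_add_one _ hs1]
    ring_nf
  have hn := norm_Gamma_le (s := s + 2) (by simp [hre]; linarith)
  rw [e, norm_mul, norm_mul] at hn
  have h1 : ‖s‖ ^ 2 = c ^ 2 + t ^ 2 := by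
    rw [Complex.sq_norm, Complex.normSq_apply, hre, him]; ring
  have h2 : ‖s‖ ≤ ‖s + 1‖ := by
    refine abs_le_of_sq_le_sq' ?_ (norm_nonneg _) |>.2
    rw [Complex.sq_norm, Complex.sq_norm, Complex.normSq_apply, Complex.normSq_apply]
    simp [hre]; nlinarith
  have h0 : 0 ≤ ‖Complex.Gamma s‖ := norm_nonneg _
  rw [← div_eq_mul_inv, le_div_iff₀ (by positivity), ← h1]
  simp only [Complex.add_re, hre, Complex.re_ofNat] at hn
  nlinarith [norm_nonneg s, mul_nonneg h0 (norm_nonneg s)]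

/-! ### Gaussian scale mixtures -/

theorem gaussianPDFReal_zero_sq_eq (τ z : ℝ) :
    gaussianPDFReal 0 (τ ^ 2).toNNReal z =
      (√(2 * Real.pi) * |τ|)⁻¹ * (Real.exp (z ^ 2 / (2 * |τ| ^ 2)))⁻¹ := by
  rw [gaussianPDFReal, Real.coe_toNNReal _ (sq_nonneg τ), Real.sqrt_mul (by positivity),
    Real.sqrt_sq_eq_abs, ← Real.exp_neg, sq_abs, sub_zero, neg_div]

theorem one_le_sqrt_two_pi : 1 ≤ √(2 * Real.pi) := by
  rw [Real.one_le_sqrt]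
  linarith [Real.pi_gt_three]

/-- The bound is uniform in τ, hence serves as a dominating constant for mixtures. It follows from
e^u ≥ 1 + u and (|z| - |τ|)² ≥ 0; at τ = 0 the density is 0 by convention. -/
theorem gaussianPDFReal_le_inv_abs (τ : ℝ) {z : ℝ} (hz : z ≠ 0) :
    gaussianPDFReal 0 (τ ^ 2).toNNReal z ≤ |z|⁻¹ := by
  rcases eq_or_ne τ 0 with rfl | hτ
  · simp
  have hz' := abs_pos.2 hz
  have hτ' := abs_pos.2 hτ
  rw [gaussianPDFReal_zero_sq_eq, ← mul_inv]
  refine inv_anti₀ hz' ?_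
  have h1 := Real.add_one_le_exp (z ^ 2 / (2 * |τ| ^ 2))
  calc |z| ≤ 1 * |τ| * (z ^ 2 / (2 * |τ| ^ 2) + 1) := by
        rw [← sq_abs z]
        field_simp
        nlinarith [sq_nonneg (|z| - |τ|)]
    _ ≤ √(2 * Real.pi) * |τ| * Real.exp (z ^ 2 / (2 * |τ| ^ 2)) := by
        gcongr
        exact one_le_sqrt_two_pi

/-- Here e^u ≥ u²/2 with u = z²/(2τ²), which produces the 8. The z⁻⁴ decay controls the density of a
reciprocal near 0. -/
theorem gaussianPDFReal_le_cube (τ : ℝ) {z : ℝ} (hz : z ≠ 0) :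
    gaussianPDFReal 0 (τ ^ 2).toNNReal z ≤ 8 * (z ^ 4)⁻¹ * |τ| ^ 3 := by
  rcases eq_or_ne τ 0 with rfl | hτ
  · simp
  have hτ' := abs_pos.2 hτ
  have hz4 : 0 < z ^ 4 := by positivity
  rw [gaussianPDFReal_zero_sq_eq, ← mul_inv]
  have h1 := Real.quadratic_le_exp_of_nonneg (x := z ^ 2 / (2 * |τ| ^ 2)) (by positivity)
  have h2 : 0 ≤ z ^ 2 / (2 * |τ| ^ 2) := by positivity
  calc (√(2 * Real.pi) * |τ| * Real.exp (z ^ 2 / (2 * |τ| ^ 2)))⁻¹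
      ≤ (1 * |τ| * ((z ^ 2 / (2 * |τ| ^ 2)) ^ 2 / 2))⁻¹ := by
        refine inv_anti₀ (by positivity) ?_
        gcongr
        · exact one_le_sqrt_two_pi
        · linarith
    _ = 8 * (z ^ 4)⁻¹ * |τ| ^ 3 := by
        field_simp
        norm_num

/-- The density of `X * W` for `X ∼ N(0, σ²)` and an independent `W ∼ ν`. -/
noncomputable def gaussianScaleMixture (σ : ℝ) (ν : Measure ℝ) (z : ℝ) : ℝ≥0∞ :=
  ∫⁻ w, gaussianPDF 0 ((σ * w) ^ 2).toNNReal z ∂ν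

theorem measurable_gaussianPDF_sq {α : Type*} [MeasurableSpace α] {τ z : α → ℝ}
    (hτ : Measurable τ) (hz : Measurable z) :
    Measurable fun a => gaussianPDF 0 (τ a ^ 2).toNNReal (z a) := by
  have h : Measurable fun a => ((0 : ℝ), (τ a ^ 2).toNNReal, z a) :=
    measurable_const.prodMk ((hτ.pow_const 2).real_toNNReal.prodMk hz)
  exact measurable_uncurry_gaussianPDF.comp h

theorem gaussianScaleMixture_neg (σ : ℝ) (ν : Measure ℝ) (z : ℝ) :
    gaussianScaleMixture σ ν (-z) = gaussianScaleMixture σ ν z := by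
  simp [gaussianScaleMixture, gaussianPDF, gaussianPDFReal]

theorem gaussianScaleMixture_ne_top (σ : ℝ) (ν : Measure ℝ) [IsFiniteMeasure ν] {z : ℝ}
    (hz : z ≠ 0) : gaussianScaleMixture σ ν z ≠ ∞ := by
  refine ne_top_of_le_ne_top (b := ∫⁻ _, ENNReal.ofReal |z|⁻¹ ∂ν) ?_
    (lintegral_mono fun w => ENNReal.ofReal_le_ofReal (gaussianPDFReal_le_inv_abs _ hz))
  simpa using ENNReal.mul_ne_top ENNReal.ofReal_ne_top (measure_ne_top _ _)

theorem continuous_gaussianPDF (v : NNReal) : Continuous (gaussianPDF 0 v) := by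
  refine ENNReal.continuous_ofReal.comp ?_
  unfold gaussianPDFReal
  fun_prop

theorem gaussianPDF_le_zero (v : NNReal) (z : ℝ) : gaussianPDF 0 v z ≤ gaussianPDF 0 v 0 := by
  refine ENNReal.ofReal_le_ofReal ?_
  unfold gaussianPDFReal
  refine mul_le_mul_of_nonneg_left (Real.exp_le_exp.2 ?_) (by positivity)
  refine div_le_div_of_nonneg_right ?_ (by positivity)
  simpa using sq_nonneg z

/-- Away from 0 this is dominated convergence. At 0 the value may be infinite, so no dominating
function need exist: Fatou bounds the liminf from below, and each Gaussian density peaking at 0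
bounds the limsup from above. -/
theorem continuous_gaussianScaleMixture (σ : ℝ) (ν : Measure ℝ) [IsFiniteMeasure ν] :
    Continuous (gaussianScaleMixture σ ν) := by
  have hm (z : ℝ) : Measurable fun w => gaussianPDF 0 ((σ * w) ^ 2).toNNReal z :=
    measurable_gaussianPDF_sq (τ := fun w => σ * w) (z := fun _ => z) (by fun_prop) (by fun_prop)
  refine continuous_iff_continuousAt.2 fun z₀ => ?_
  rcases eq_or_ne z₀ 0 with rfl | hz₀
  · have hlow : gaussianScaleMixture σ ν 0 ≤
        Filter.liminf (fun z => gaussianScaleMixture σ ν z) (nhds 0) := by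
      have h := lintegral_liminf_le (μ := ν) (u := nhds (0 : ℝ)) hm
      have h' (w : ℝ) :
          Filter.liminf (fun z => gaussianPDF 0 ((σ * w) ^ 2).toNNReal z) (nhds 0) =
            gaussianPDF 0 ((σ * w) ^ 2).toNNReal 0 :=
        ((continuous_gaussianPDF ((σ * w) ^ 2).toNNReal).tendsto 0).liminf_eq
      simpa only [h', gaussianScaleMixture] using h
    refine tendsto_of_le_liminf_of_limsup_le hlow ?_
    · exact Filter.limsup_le_of_le (h := .of_forall fun z =>
        lintegral_mono fun w => gaussianPDF_le_zero _ _)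
  · refine tendsto_lintegral_filter_of_dominated_convergence
      (fun _ => ENNReal.ofReal (2 * |z₀|⁻¹)) (.of_forall hm) ?_ ?_
      (.of_forall fun w => (continuous_gaussianPDF _).tendsto _)
    · have hpos := abs_pos.2 hz₀
      filter_upwards [continuous_abs.continuousAt.eventually_const_lt (half_lt_self hpos)]
        with z hz
      have hz' : 0 < |z| := (half_pos hpos).trans hz
      refine .of_forall fun w => ENNReal.ofReal_le_ofReal
        ((gaussianPDFReal_le_inv_abs _ (abs_pos.1 hz')).trans ?_)
      rw [← div_eq_mul_inv, inv_eq_one_div, div_le_div_iff₀ hz' hpos]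
      linarith
    · rw [lintegral_const]
      exact ENNReal.mul_ne_top ENNReal.ofReal_ne_top (measure_ne_top _ _)

theorem gaussianScaleMixture_le {σ : ℝ} (hσ : 0 < σ) (ν : Measure ℝ) {z : ℝ} (hz : z ≠ 0) :
    gaussianScaleMixture σ ν z ≤
      ENNReal.ofReal (8 * σ ^ 3 * (z ^ 4)⁻¹) * ∫⁻ w, ENNReal.ofReal (|w| ^ 3) ∂ν := by
  rw [← lintegral_const_mul _ (by fun_prop)]
  refine lintegral_mono fun w => ?_
  rw [← ENNReal.ofReal_mul (by positivity)]
  refine ENNReal.ofReal_le_ofReal ((gaussianPDFReal_le_cube _ hz).trans_eq ?_)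
  rw [abs_mul, abs_of_pos hσ]
  ring

theorem gaussianReal_map_mul_apply {σ w : ℝ} (hσ : 0 < σ) (hw : w ≠ 0) {A : Set ℝ}
    (hA : MeasurableSet A) :
    gaussianReal 0 (σ ^ 2).toNNReal ((fun x => x * w) ⁻¹' A) =
      ∫⁻ z in A, gaussianPDF 0 ((σ * w) ^ 2).toNNReal z := by
  have hv : ((σ * w) ^ 2).toNNReal ≠ 0 :=
    (Real.toNNReal_pos.2 (by positivity)).ne'
  have h := gaussianReal_map_mul_const (μ := 0) (v := (σ ^ 2).toNNReal) w
  have hvar : NNReal.mk (w ^ 2) (sq_nonneg w) * (σ ^ 2).toNNReal = ((σ * w) ^ 2).toNNReal := by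
    apply NNReal.coe_injective
    rw [NNReal.coe_mul, NNReal.coe_mk, Real.coe_toNNReal _ (sq_nonneg _),
      Real.coe_toNNReal _ (sq_nonneg _)]
    ring
  rw [mul_zero, hvar] at h
  rw [← gaussianReal_apply _ hv, ← h, Measure.map_apply (by fun_prop) hA]

/-- By Tonelli, conditionally on w the product is N(0, σ²w²). The value w = 0 must be negligible,
since it would contribute an atom at 0. -/
theorem gaussianReal_prod_map_mul {σ : ℝ} (hσ : 0 < σ) {ν : Measure ℝ} [SFinite ν]
    (hν : ∀ᵐ w ∂ν, w ≠ 0) :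
    ((gaussianReal 0 (σ ^ 2).toNNReal).prod ν).map (fun p => p.1 * p.2) =
      volume.withDensity (gaussianScaleMixture σ ν) := by
  ext A hA
  have hmul : Measurable fun p : ℝ × ℝ => p.1 * p.2 := by fun_prop
  have hjoint : Measurable (Function.uncurry fun z w : ℝ =>
      gaussianPDF 0 ((σ * w) ^ 2).toNNReal z) :=
    measurable_gaussianPDF_sq (τ := fun p : ℝ × ℝ => σ * p.2) (z := fun p => p.1) (by fun_prop)
      (by fun_prop)
  rw [Measure.map_apply hmul hA, Measure.prod_apply_symm (hmul hA), withDensity_apply _ hA]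
  have hswap := lintegral_lintegral_swap (μ := volume.restrict A) (ν := ν) hjoint.aemeasurable
  simp only [gaussianScaleMixture]
  rw [hswap]
  refine lintegral_congr_ae ?_
  filter_upwards [hν] with w hw
  rw [← gaussianReal_map_mul_apply hσ hw hA, ← Set.preimage_comp]
  rfl

/-! ### A continuous even density for the quotient -/

theorem hasLaw_gaussian_mul {Ω : Type*} [MeasurableSpace Ω] {P : Measure Ω}
    [IsProbabilityMeasure P] {X W : Ω → ℝ} {σ : ℝ} (hσ : 0 < σ)
    (hX : HasLaw X (gaussianReal 0 (σ ^ 2).toNNReal) P) (hW : AEMeasurable W P)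
    (hW0 : ∀ᵐ ω ∂P, W ω ≠ 0) (hind : IndepFun X W P) :
    HasLaw (fun ω => X ω * W ω) (volume.withDensity (gaussianScaleMixture σ (P.map W))) P where
  aemeasurable := hX.aemeasurable.mul hW
  map_eq := by
    have : IsProbabilityMeasure (P.map W) := Measure.isProbabilityMeasure_map hW
    have hpair := (indepFun_iff_hasLaw_prodMk_prod hX ⟨hW, rfl⟩).1 hind
    have hW0' : ∀ᵐ w ∂P.map W, w ≠ 0 :=
      (ae_map_iff hW (measurableSet_singleton (0 : ℝ)).compl).2 hW0
    have hmul : Measurable fun p : ℝ × ℝ => p.1 * p.2 := by fun_prop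
    rw [← gaussianReal_prod_map_mul hσ hW0', ← hpair.map_eq,
      AEMeasurable.map_map_of_aemeasurable hmul.aemeasurable hpair.aemeasurable]
    rfl

/-- Change of variables under x ↦ x⁻¹, after removing the null point 0, where the inverse is 0 by
convention and has no derivative. -/
theorem hasLaw_inv_withDensity {Ω : Type*} [MeasurableSpace Ω] {P : Measure Ω} {V : Ω → ℝ}
    {f : ℝ → ℝ≥0∞} (hV : HasLaw V (volume.withDensity f) P) :
    HasLaw (fun ω => (V ω)⁻¹)
      (volume.withDensity fun z => ENNReal.ofReal (z ^ 2)⁻¹ * f z⁻¹) P where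
  aemeasurable := hV.aemeasurable.inv
  map_eq := by
    ext A hA
    have hinv : Measurable fun x : ℝ => x⁻¹ := measurable_inv
    have e : P.map (fun ω => (V ω)⁻¹) = (volume.withDensity f).map fun x => x⁻¹ := by
      rw [← hV.map_eq, AEMeasurable.map_map_of_aemeasurable hinv.aemeasurable hV.aemeasurable]
      rfl
    have hae (B : Set ℝ) : (B \ {0} : Set ℝ) =ᵐ[volume] B :=
      sdiff_null_ae_eq_self (measure_singleton 0)
    have himg : (fun x : ℝ => x⁻¹) '' (A \ {0}) = ((fun x : ℝ => x⁻¹) ⁻¹' A) \ {0} := by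
      ext x
      constructor
      · rintro ⟨y, ⟨hy, hy0⟩, rfl⟩
        exact ⟨by simpa using hy, by simpa using hy0⟩
      · rintro ⟨hx, hx0⟩
        exact ⟨x⁻¹, ⟨hx, by simpa using hx0⟩, inv_inv x⟩
    have hd (x : ℝ) (hx : x ∈ A \ {0}) :
        HasDerivWithinAt (fun x : ℝ => x⁻¹) (-(x ^ 2)⁻¹) (A \ {0}) x :=
      (hasDerivAt_inv hx.2).hasDerivWithinAt
    rw [e, Measure.map_apply hinv hA, withDensity_apply _ (hinv hA), withDensity_apply _ hA,
      ← setLIntegral_congr (hae ((fun x : ℝ => x⁻¹) ⁻¹' A)), ← himg,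
      lintegral_image_eq_lintegral_abs_deriv_mul (hA.diff (measurableSet_singleton 0)) hd
        inv_injective.injOn, setLIntegral_congr (hae A)]
    simp [abs_of_nonneg, sq_nonneg]

theorem continuous_inv_gaussianScaleMixture {σ : ℝ} (hσ : 0 < σ) {ν : Measure ℝ}
    [IsFiniteMeasure ν] (hν : ∫⁻ w, ENNReal.ofReal (|w| ^ 3) ∂ν ≠ ∞) :
    Continuous fun z : ℝ => ENNReal.ofReal (z ^ 2)⁻¹ * gaussianScaleMixture σ ν z⁻¹ := by
  refine continuous_iff_continuousAt.2 fun z₀ => ?_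
  rcases eq_or_ne z₀ 0 with rfl | hz₀
  · set K := ∫⁻ w, ENNReal.ofReal (|w| ^ 3) ∂ν
    have hlim : Filter.Tendsto (fun z : ℝ => ENNReal.ofReal (8 * σ ^ 3 * z ^ 2) * K) (nhds 0)
        (nhds 0) := by
      have h : Continuous fun z : ℝ => ENNReal.ofReal (8 * σ ^ 3 * z ^ 2) :=
        ENNReal.continuous_ofReal.comp (by fun_prop)
      simpa using ENNReal.Tendsto.mul_const (h.tendsto 0) (Or.inr hν)
    -- At z = 0 the convention 0⁻¹ = 0 makes the first factor 0, and 0 · ∞ = 0. This agrees with the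
    -- limit: z⁻² times a mixture of order z⁴ is of order z².
    have h0 : ENNReal.ofReal ((0 : ℝ) ^ 2)⁻¹ * gaussianScaleMixture σ ν (0 : ℝ)⁻¹ = 0 := by simp
    rw [ContinuousAt, h0]
    refine tendsto_of_tendsto_of_tendsto_of_le_of_le tendsto_const_nhds hlim
      (fun _ => zero_le) fun z => ?_
    rcases eq_or_ne z 0 with rfl | hz
    · simp
    refine (mul_le_mul_right (gaussianScaleMixture_le hσ ν (inv_ne_zero hz)) _).trans_eq ?_
    rw [← mul_assoc, ← ENNReal.ofReal_mul (by positivity)]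
    congr 2
    field_simp
  · have hinv : ContinuousAt (fun z : ℝ => z⁻¹) z₀ := continuousAt_inv₀ hz₀
    refine ENNReal.Tendsto.mul ?_ (Or.inr ?_) ?_ (Or.inr ENNReal.ofReal_ne_top)
    · exact (ENNReal.continuous_ofReal.tendsto _).comp
        ((continuous_pow 2).continuousAt.inv₀ (pow_ne_zero 2 hz₀))
    · exact gaussianScaleMixture_ne_top σ ν (inv_ne_zero hz₀)
    · exact ((continuous_gaussianScaleMixture σ ν).tendsto _).comp hinv

theorem indepFun_comp_erase {Ω ι : Type*} [Fintype ι] [DecidableEq ι] [MeasurableSpace Ω]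
    {P : Measure Ω} {U : ι → Ω → ℝ} (hU : ∀ i, AEMeasurable (U i) P) (hind : iIndepFun U P)
    (i₀ : ι) {g : (↥(Finset.univ.erase i₀) → ℝ) → ℝ} (hg : Measurable g) :
    IndepFun (U i₀) (fun ω => g fun i => U i ω) P := by
  have h := hind.indepFun_finset₀ {i₀} (Finset.univ.erase i₀) (by simp) hU
  exact h.comp (φ := fun p : ({i₀} : Finset ι) → ℝ => p ⟨i₀, Finset.mem_singleton_self i₀⟩)
    (measurable_pi_apply _) hg

theorem ae_ne_zero_of_hasLaw_gaussianReal {Ω : Type*} [MeasurableSpace Ω] {P : Measure Ω} {X : Ω → ℝ}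
    {σ : ℝ} (hσ : 0 < σ) (hX : HasLaw X (gaussianReal 0 (σ ^ 2).toNNReal) P) :
    ∀ᵐ ω ∂P, X ω ≠ 0 := by
  have := nullSingletonClass_gaussianReal (μ := 0) (toNNReal_sq_ne_zero hσ)
  rw [hX.ae_iff (p := fun x => x ≠ 0)
    (measurableSet_setOfPred.1 (measurableSet_singleton (0 : ℝ)).compl)]
  exact compl_mem_ae_iff.2 (measure_singleton 0)

theorem exists_even_continuous_density {Ω : Type*} [MeasurableSpace Ω] {P : Measure Ω}
    [IsProbabilityMeasure P] {M N : ℕ} (hMN : 1 ≤ M + N)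
    {X : Fin M → Ω → ℝ} {Y : Fin N → Ω → ℝ} {σX : Fin M → ℝ} {σY : Fin N → ℝ}
    (hσX : ∀ i, 0 < σX i) (hσY : ∀ j, 0 < σY j)
    (hX : ∀ i, HasLaw (X i) (gaussianReal 0 (σX i ^ 2).toNNReal) P)
    (hY : ∀ j, HasLaw (Y j) (gaussianReal 0 (σY j ^ 2).toNNReal) P)
    (hind : iIndepFun (Sum.elim X Y) P) :
    ∃ f : ℝ → ℝ≥0∞, Continuous f ∧
      HasLaw (fun ω => (∏ i, X i ω) / ∏ j, Y j ω) (volume.withDensity f) P ∧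
      (∀ z, f (-z) = f z) ∧ ∀ z, z ≠ 0 → f z ≠ ∞ := by
  have hU : ∀ i, AEMeasurable (Sum.elim X Y i) P := by
    rintro (i | j)
    · exact (hX i).aemeasurable
    · exact (hY j).aemeasurable
  have hX0 : ∀ᵐ ω ∂P, ∀ i, X i ω ≠ 0 :=
    ae_all_iff.2 fun i => ae_ne_zero_of_hasLaw_gaussianReal (hσX i) (hX i)
  have hY0 : ∀ᵐ ω ∂P, ∀ j, Y j ω ≠ 0 :=
    ae_all_iff.2 fun j => ae_ne_zero_of_hasLaw_gaussianReal (hσY j) (hY j)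
  rcases M with _ | m
  -- Empty numerator: Z is the reciprocal of Y₀ W, and the finite third moment of W yields
  -- continuity at 0.
  · obtain ⟨n, rfl⟩ : ∃ n, N = n + 1 := ⟨N - 1, by omega⟩
    set W : Ω → ℝ := fun ω => ∏ j : Fin n, Y j.succ ω with hW
    have hWm : AEMeasurable W P :=
      Finset.aemeasurable_fun_prod _ fun j _ => (hY j.succ).aemeasurable
    have : IsProbabilityMeasure (P.map W) := Measure.isProbabilityMeasure_map hWm
    have hW0 : ∀ᵐ ω ∂P, W ω ≠ 0 := by
      filter_upwards [hY0] with ω h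
      exact Finset.prod_ne_zero_iff.2 fun j _ => h _
    have hindW : IndepFun (Y 0) W P :=
      indepFun_comp_erase hU hind (Sum.inr 0)
        (g := fun p => ∏ j : Fin n, p ⟨Sum.inr j.succ, by simp⟩) (by fun_prop)
    have hindY : iIndepFun (fun j : Fin n => Y j.succ) P :=
      hind.precomp (g := fun j : Fin n => Sum.inr j.succ)
        (Sum.inr_injective.comp (Fin.succ_injective n))
    have hint : Integrable (fun ω => |W ω| ^ 3) P := by
      have h := (integrable_prod_abs_cpow (fun j : Fin n => hσY j.succ) (fun j => hY j.succ) hindY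
        -- The exponent is a cast natural number, so that the complex power simplifies to an
        -- ordinary cube.
        (r := fun _ => (3 : ℕ)) (fun _ => by simp; norm_num)).norm
      refine h.congr (.of_forall fun ω => ?_)
      simp [hW, Finset.abs_prod, Finset.prod_pow, -Nat.cast_ofNat]
    have hcube : ∫⁻ w, ENNReal.ofReal (|w| ^ 3) ∂P.map W ≠ ∞ := by
      rw [lintegral_map' (by fun_prop) hWm]
      exact hint.lintegral_lt_top.ne
    have hlaw := hasLaw_inv_withDensity (hasLaw_gaussian_mul (hσY 0) (hY 0) hWm hW0 hindW)
    refine ⟨_, continuous_inv_gaussianScaleMixture (hσY 0) hcube, ?_, fun z => ?_, fun z hz => ?_⟩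
    · refine hlaw.congr (.of_forall fun ω => ?_)
      simp [Fin.prod_univ_succ, hW]
    · simp [inv_neg, gaussianScaleMixture_neg]
    · exact ENNReal.mul_ne_top ENNReal.ofReal_ne_top
        (gaussianScaleMixture_ne_top _ _ (inv_ne_zero hz))
  · set W : Ω → ℝ := fun ω => (∏ i : Fin m, X i.succ ω) / ∏ j, Y j ω with hW
    have hWm : AEMeasurable W P :=
      (Finset.aemeasurable_fun_prod _ fun i _ => (hX i.succ).aemeasurable).div
        (Finset.aemeasurable_fun_prod _ fun j _ => (hY j).aemeasurable)
    have : IsProbabilityMeasure (P.map W) := Measure.isProbabilityMeasure_map hWm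
    have hW0 : ∀ᵐ ω ∂P, W ω ≠ 0 := by
      filter_upwards [hX0, hY0] with ω h h'
      exact div_ne_zero (Finset.prod_ne_zero_iff.2 fun j _ => h _)
        (Finset.prod_ne_zero_iff.2 fun j _ => h' _)
    have hindW : IndepFun (X 0) W P :=
      indepFun_comp_erase hU hind (Sum.inl 0)
        (g := fun p => (∏ i : Fin m, p ⟨Sum.inl i.succ, by simp⟩) /
          ∏ j : Fin N, p ⟨Sum.inr j, by simp⟩) (by fun_prop)
    refine ⟨_, continuous_gaussianScaleMixture (σX 0) (P.map W), ?_,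
      gaussianScaleMixture_neg _ _, fun z hz => gaussianScaleMixture_ne_top _ _ hz⟩
    refine (hasLaw_gaussian_mul (hσX 0) (hX 0) hWm hW0 hindW).congr (.of_forall fun ω => ?_)
    simp only [hW, Fin.prod_univ_succ, mul_div_assoc]

/-! ### Powers of products, and integrability of the Gamma product -/

theorem ofReal_prod_cpow {ι : Type*} (s : Finset ι) {a : ι → ℝ} (ha : ∀ i, 0 ≤ a i) (r : ℂ) :
    ((∏ i ∈ s, a i : ℝ) : ℂ) ^ r = ∏ i ∈ s, (a i : ℂ) ^ r := by
  classical
  induction s using Finset.induction_on with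
  | empty => simp
  | insert i s hi ih =>
    rw [Finset.prod_insert hi, Finset.prod_insert hi, Complex.ofReal_mul,
      Complex.mul_cpow_ofReal_nonneg (ha i) (Finset.prod_nonneg fun j _ => ha j), ih]

theorem ofReal_prod_div_prod_cpow {ι κ : Type*} [Fintype ι] [Fintype κ] {a : ι → ℝ} {b : κ → ℝ}
    (ha : ∀ i, 0 ≤ a i) (hb : ∀ j, 0 ≤ b j) (r : ℂ) :
    (((∏ i, a i) / ∏ j, b j : ℝ) : ℂ) ^ r = (∏ i, (a i : ℂ) ^ r) * ∏ j, (b j : ℂ) ^ (-r) := by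
  rw [Complex.ofReal_div, Complex.div_cpow_ofReal_nonneg (Finset.prod_nonneg fun i _ => ha i)
    (Finset.prod_nonneg fun j _ => hb j), ofReal_prod_cpow _ ha, div_eq_mul_inv,
    ← Complex.cpow_neg, ofReal_prod_cpow _ hb]

/-- The product `Γ(v)^M Γ(1 - v)^N`. -/
noncomputable def gammaProd (M N : ℕ) (v : ℂ) : ℂ :=
  Complex.Gamma v ^ M * Complex.Gamma (1 - v) ^ N

theorem re_add_mul_I (c t : ℝ) : ((c : ℂ) + t * Complex.I).re = c := by simp

theorem norm_Gamma_pow_le {M : ℕ} {s : ℂ} (hs : M ≠ 0 → 0 < s.re) :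
    ‖Complex.Gamma s ^ M‖ ≤ Real.Gamma s.re ^ M := by
  rcases eq_or_ne M 0 with rfl | hM
  · simp
  · rw [norm_pow]
    gcongr
    exact norm_Gamma_le (hs hM)

theorem continuous_Gamma_pow_comp {M : ℕ} {s : ℝ → ℂ} (hs : Continuous s)
    (h : M ≠ 0 → ∀ t, 0 < (s t).re) : Continuous fun t => Complex.Gamma (s t) ^ M := by
  rcases eq_or_ne M 0 with rfl | hM
  · simpa using continuous_const
  · refine Continuous.pow (continuous_iff_continuousAt.2 fun t => ?_) M
    refine ContinuousAt.comp (g := Complex.Gamma)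
      (Complex.differentiableAt_Gamma _ fun m hm => ?_).continuousAt hs.continuousAt
    have := h hM t
    rw [hm] at this
    simp at this
    linarith [m.cast_nonneg (α := ℝ)]

theorem continuous_gammaProd_line {M N : ℕ} {c : ℝ} (hM : M ≠ 0 → 0 < c) (hN : N ≠ 0 → c < 1) :
    Continuous fun t : ℝ => gammaProd M N (c + t * Complex.I) :=
  (continuous_Gamma_pow_comp (by fun_prop) fun h t => by simpa using hM h).mul
    (continuous_Gamma_pow_comp (by fun_prop) fun h t => by simpa using hN h)

theorem integrable_inv_sq_add_sq {c : ℝ} (hc : 0 < c) :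
    Integrable fun t : ℝ => (c ^ 2 + t ^ 2)⁻¹ := by
  refine ((integrable_inv_one_add_sq.comp_div hc.ne').const_mul (c ^ 2)⁻¹).congr
    (.of_forall fun t => ?_)
  simp only
  rw [← mul_inv]
  congr 1
  field_simp

/-- One factor Γ(v) supplies the quadratic decay; all the others are bounded by their values at the
real part. -/
theorem integrable_gammaProd_line_of_ne_zero {M N : ℕ} (hM0 : M ≠ 0) {c : ℝ} (hM : 0 < c)
    (hN : N ≠ 0 → c < 1) : Integrable fun t : ℝ => gammaProd M N (c + t * Complex.I) := by
  obtain ⟨m, rfl⟩ := Nat.exists_eq_succ_of_ne_zero hM0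
  refine ((integrable_inv_sq_add_sq hM).const_mul
    (Real.Gamma c ^ m * Real.Gamma (c + 2) * Real.Gamma (1 - c) ^ N)).mono'
    (continuous_gammaProd_line (fun _ => hM) hN).aestronglyMeasurable (.of_forall fun t => ?_)
  have h1 := norm_Gamma_pow_le (M := m) (s := c + t * Complex.I) fun _ => by simpa using hM
  have h2 := norm_Gamma_pow_le (M := N) (s := 1 - (c + t * Complex.I)) fun h => by
    simpa using hN h
  have h3 := norm_Gamma_le_inv_sq hM t
  rw [re_add_mul_I] at h1
  rw [Complex.sub_re, re_add_mul_I, Complex.one_re] at h2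
  have hG := (Real.Gamma_pos_of_pos hM).le
  have hG2 := (Real.Gamma_pos_of_pos (show 0 < c + 2 by linarith)).le
  rw [gammaProd, Nat.succ_eq_add_one, pow_succ, norm_mul, norm_mul]
  calc _ ≤ Real.Gamma c ^ m * (Real.Gamma (c + 2) * (c ^ 2 + t ^ 2)⁻¹) *
          Real.Gamma (1 - c) ^ N := by gcongr
    _ = _ := by ring

theorem integrable_gammaProd_line {M N : ℕ} (hMN : 1 ≤ M + N) {c : ℝ} (hM : M ≠ 0 → 0 < c)
    (hN : N ≠ 0 → c < 1) : Integrable fun t : ℝ => gammaProd M N (c + t * Complex.I) := by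
  rcases eq_or_ne M 0 with h0 | h0
  · have hN0 : N ≠ 0 := by omega
    -- The reflection v ↦ 1 - v exchanges the two Gamma powers.
    have h := integrable_gammaProd_line_of_ne_zero (N := M) hN0 (c := 1 - c)
      (by linarith [hN hN0]) (fun h => absurd h0 h)
    refine h.comp_neg.congr (.of_forall fun t => ?_)
    simp only [gammaProd]
    rw [mul_comm]
    congr 3 <;> push_cast <;> ring_nf
  · exact integrable_gammaProd_line_of_ne_zero h0 (hM h0) hN

/-! ### Mellin transform of an even density and its inversion -/

/-- Evenness folds the moment over the real line onto twice the half-line integral. A possible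
infinite value at 0, sent to 0 by `toReal`, sits on a null set. -/
theorem mellin_even_density {Ω : Type*} [MeasurableSpace Ω] {P : Measure Ω} {Z : Ω → ℝ}
    {f : ℝ → ℝ≥0∞} (hf : Measurable f) (hZ : HasLaw Z (volume.withDensity f) P)
    (heven : ∀ z, f (-z) = f z) (hfin : ∀ z, z ≠ 0 → f z ≠ ∞) {w : ℂ}
    (hint : Integrable (fun ω => ((|Z ω| : ℝ) : ℂ) ^ (w - 1)) P) :
    MellinConvergent (fun z => ((f z).toReal : ℂ)) w ∧
      mellin (fun z => ((f z).toReal : ℂ)) w = (∫ ω, ((|Z ω| : ℝ) : ℂ) ^ (w - 1) ∂P) / 2 := by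
  have hm : Measurable fun x : ℝ => ((|x| : ℝ) : ℂ) ^ (w - 1) := by fun_prop
  have habs (z : ℝ) : f |z| = f z := by
    rcases abs_choice z with h | h <;> rw [h]
    exact heven z
  have hlt : ∀ᵐ z, f z < ∞ := by
    filter_upwards [compl_mem_ae_iff.2 (measure_singleton (0 : ℝ))] with z hz
    exact (hfin z hz).lt_top
  have e (z : ℝ) : (f z).toReal • ((|z| : ℝ) : ℂ) ^ (w - 1) =
      (fun t : ℝ => (t : ℂ) ^ (w - 1) • ((f t).toReal : ℂ)) |z| := by
    simp only [habs, Complex.real_smul, smul_eq_mul, mul_comm]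
  have hconv : MellinConvergent (fun z => ((f z).toReal : ℂ)) w := by
    have h : Integrable (fun x : ℝ => ((|x| : ℝ) : ℂ) ^ (w - 1)) (volume.withDensity f) := by
      rw [← hZ.map_eq, integrable_map_measure hm.aestronglyMeasurable hZ.aemeasurable]
      exact hint
    rw [integrable_withDensity_iff_integrable_smul' hf hlt] at h
    simp only [e] at h
    exact (integrable_comp_abs_iff _).1 h
  refine ⟨hconv, ?_⟩
  have h := hZ.integral_comp hm.aestronglyMeasurable
  simp only [Function.comp_def] at h
  rw [h, integral_withDensity_eq_integral_toReal_smul hf hlt]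
  simp only [e]
  rw [integral_comp_abs_eq_two_smul hconv, mellin, Complex.real_smul, Complex.ofReal_ofNat]
  field_simp

/-- Inversion along Re w = 2c with w = 2v: the Jacobian 2 cancels the 1/2 in the transform, and
z^(-2v) A^(2v-1) = A⁻¹ ((z/A)²)^(-v). -/
theorem mellin_inversion_scaled {F : ℝ → ℂ} {c A : ℝ} {K : ℂ} {G : ℂ → ℂ} (hA : 0 < A)
    (hconv : MellinConvergent F ((2 * c : ℝ) : ℂ))
    (hF : ∀ t : ℝ, mellin F (2 * (c + t * Complex.I)) =
      K / 2 * (A : ℂ) ^ (2 * (c + t * Complex.I) - 1) * G (c + t * Complex.I))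
    (hG : Integrable fun t : ℝ => G (c + t * Complex.I))
    {z : ℝ} (hz : 0 < z) (hcont : ContinuousAt F z) :
    F z = K / A * ((2 * Real.pi)⁻¹ *
      ∫ t : ℝ, (((z / A) ^ 2 : ℝ) : ℂ) ^ (-(c + t * Complex.I)) * G (c + t * Complex.I)) := by
  have hA' : (A : ℂ) ≠ 0 := by exact_mod_cast hA.ne'
  have hcast (t : ℝ) : ((2 * c : ℝ) : ℂ) + ((2 * t : ℝ) : ℂ) * Complex.I =
      2 * (c + t * Complex.I) := by push_cast; ring
  have hvert : Complex.VerticalIntegrable (mellin F) (2 * c) := by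
    rw [Complex.VerticalIntegrable, ← integrable_comp_mul_left_iff _ two_ne_zero]
    simp only [hcast, hF]
    refine Integrable.bdd_mul (c := ‖K / 2‖ * A ^ (2 * c - 1)) hG ?_ (.of_forall fun t => ?_)
    · refine (continuous_const.mul ?_).aestronglyMeasurable
      exact Continuous.const_cpow (by fun_prop) (Or.inl hA')
    · rw [norm_mul, Complex.norm_cpow_eq_rpow_re_of_pos hA]
      simp
  have hinv := mellinInv_mellin_eq (2 * c) F hz hconv hvert hcont
  rw [← hinv, mellinInv]
  have hsub := Measure.integral_comp_mul_left (fun y : ℝ =>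
    (z : ℂ) ^ (-(((2 * c : ℝ) : ℂ) + y * Complex.I)) •
      mellin F (((2 * c : ℝ) : ℂ) + y * Complex.I)) 2
  have hint : ∀ t : ℝ, (z : ℂ) ^ (-(((2 * c : ℝ) : ℂ) + ((2 * t : ℝ) : ℂ) * Complex.I)) •
      mellin F (((2 * c : ℝ) : ℂ) + ((2 * t : ℝ) : ℂ) * Complex.I) =
      K / (2 * A) * ((((z / A) ^ 2 : ℝ) : ℂ) ^ (-(c + t * Complex.I)) * G (c + t * Complex.I)) := by
    intro t
    rw [hcast, hF, smul_eq_mul]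
    set v : ℂ := c + t * Complex.I
    have h1 : (((z / A) ^ 2 : ℝ) : ℂ) ^ (-v) = (z : ℂ) ^ (-(2 * v)) * (A : ℂ) ^ (2 * v) := by
      rw [sq, Complex.ofReal_mul, Complex.mul_cpow_ofReal_nonneg (by positivity) (by positivity),
        Complex.ofReal_div, Complex.div_cpow_ofReal_nonneg hz.le hA.le,
        show -(2 * v) = -v + -v by ring, Complex.cpow_add _ _ (by exact_mod_cast hz.ne'),
        show 2 * v = v + v by ring, Complex.cpow_add _ _ hA', Complex.cpow_neg (A : ℂ)]
      field_simp
    rw [h1, Complex.cpow_sub _ _ hA', Complex.cpow_one]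
    field_simp
  simp only [hint] at hsub
  rw [integral_const_mul] at hsub
  have hsub' : ∫ y : ℝ, (z : ℂ) ^ (-(((2 * c : ℝ) : ℂ) + y * Complex.I)) •
      mellin F (((2 * c : ℝ) : ℂ) + y * Complex.I) = 2 * (K / (2 * A) *
      ∫ t : ℝ, (((z / A) ^ 2 : ℝ) : ℂ) ^ (-(c + t * Complex.I)) * G (c + t * Complex.I)) := by
    rw [hsub]
    simp
  rw [hsub']
  generalize ∫ t : ℝ, (((z / A) ^ 2 : ℝ) : ℂ) ^ (-(c + t * Complex.I)) * G (c + t * Complex.I) = J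
  simp only [Complex.real_smul]
  push_cast
  field_simp

/-! ### The Meijer integral with zero parameters -/

theorem meijerIntegrand_zero_params (M N : ℕ) (x : ℝ) (s : ℂ) :
    meijerIntegrand M N (fun _ : Fin N => 0) (fun _ : Fin M => 0) x s =
      (x : ℂ) ^ (-(-s)) * gammaProd M N (-s) := by
  simp only [meijerIntegrand, gammaProd]
  have h1 (k : ℕ) : (Finset.univ.filter fun j : Fin k => j.val < k) = Finset.univ :=
    Finset.filter_true_of_mem fun j _ => j.2
  have h2 (k : ℕ) : (Finset.univ.filter fun j : Fin k => k ≤ j.val) = ∅ :=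
    Finset.filter_false_of_mem fun j _ => not_le.2 j.2
  rw [h1, h1, h2, h2]
  simp [mul_comm]

/-- The substitution s = -v moves the line to real part -c; t ↦ -t restores its upward direction,
and the factors i cancel. -/
theorem meijerLineIntegral_zero_params (M N : ℕ) (x c : ℝ) :
    meijerLineIntegral M N (fun _ : Fin N => 0) (fun _ : Fin M => 0) x c =
      (2 * Real.pi)⁻¹ * ∫ t : ℝ, (x : ℂ) ^ (-(((-c : ℝ) : ℂ) + t * Complex.I)) *
        gammaProd M N (((-c : ℝ) : ℂ) + t * Complex.I) := by
  rw [meijerLineIntegral, ← integral_neg_eq_self, integral_mul_const]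
  have e (t : ℝ) : -((c : ℂ) + ((-t : ℝ) : ℂ) * Complex.I) = ((-c : ℝ) : ℂ) + t * Complex.I := by
    push_cast; ring
  simp only [meijerIntegrand_zero_params, e]
  generalize ∫ t : ℝ, (x : ℂ) ^ (-(((-c : ℝ) : ℂ) + t * Complex.I)) *
    gammaProd M N (((-c : ℝ) : ℂ) + t * Complex.I) = J
  have := Complex.I_ne_zero
  push_cast
  field_simp

/-- Only the poles with k = 0 bind, and an empty family imposes nothing. -/
theorem separatesPoles_zero_params_iff {M N : ℕ} {c : ℝ} :
    SeparatesPoles M N (fun _ : Fin N => 0) (fun _ : Fin M => 0) c ↔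
      (M ≠ 0 → 0 < -c) ∧ (N ≠ 0 → -c < 1) := by
  constructor
  · rintro ⟨h1, h2⟩
    refine ⟨fun h => ?_, fun h => ?_⟩
    · simpa using h1 ⟨0, Nat.pos_of_ne_zero h⟩ (Nat.pos_of_ne_zero h) 0
    · have := h2 ⟨0, Nat.pos_of_ne_zero h⟩ (Nat.pos_of_ne_zero h) 0
      simp at this
      linarith
  · rintro ⟨h1, h2⟩
    refine ⟨fun j _ k => ?_, fun j _ k => ?_⟩
    · have := h1 (by rintro rfl; exact j.elim0)
      simp
      linarith [k.cast_nonneg (α := ℝ)]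
    · have := h2 (by rintro rfl; exact j.elim0)
      simp
      linarith [k.cast_nonneg (α := ℝ)]

theorem integrable_meijerIntegrand_zero_params {M N : ℕ} (hMN : 1 ≤ M + N) {x : ℝ} (hx : 0 < x)
    {c : ℝ} (hM : M ≠ 0 → 0 < -c) (hN : N ≠ 0 → -c < 1) :
    Integrable fun t : ℝ => meijerIntegrand M N (fun _ : Fin N => 0) (fun _ : Fin M => 0) x
      (c + t * Complex.I) := by
  have hx' : (x : ℂ) ≠ 0 := by exact_mod_cast hx.ne'
  have hG := (integrable_gammaProd_line hMN hM hN).comp_neg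
  have e (t : ℝ) : -((c : ℂ) + t * Complex.I) = ((-c : ℝ) : ℂ) + ((-t : ℝ) : ℂ) * Complex.I := by
    push_cast; ring
  simp only [meijerIntegrand_zero_params, e]
  refine Integrable.bdd_mul (c := x ^ c) hG ?_ (.of_forall fun t => ?_)
  · exact (Continuous.const_cpow (by fun_prop) (Or.inl hx')).aestronglyMeasurable
  · rw [Complex.norm_cpow_eq_rpow_re_of_pos hx]
    simp

/-- A value g shared by all admissible lines gives independence of the line, so the arbitrary line
chosen in `meijerG` is harmless. -/
theorem meijerGWellDefined_of_lineIntegral_eq {M N : ℕ} (hMN : 1 ≤ M + N) {x : ℝ} (hx : 0 < x)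
    {g : ℂ}
    (hg : ∀ c : ℝ, (M ≠ 0 → 0 < c) → (N ≠ 0 → c < 1) →
      g = (2 * Real.pi)⁻¹ * ∫ t : ℝ, (x : ℂ) ^ (-(c + t * Complex.I)) *
        gammaProd M N (c + t * Complex.I)) :
    MeijerGWellDefined M N (fun _ : Fin N => 0) (fun _ : Fin M => 0) x ∧
      meijerG M N (fun _ : Fin N => 0) (fun _ : Fin M => 0) x = g := by
  have hline (c : ℝ) (hc : SeparatesPoles M N (fun _ : Fin N => 0) (fun _ : Fin M => 0) c) :
      meijerLineIntegral M N (fun _ : Fin N => 0) (fun _ : Fin M => 0) x c = g := by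
    obtain ⟨hM, hN⟩ := separatesPoles_zero_params_iff.1 hc
    rw [meijerLineIntegral_zero_params, hg (-c) hM hN]
  have hex : ∃ c : ℝ, SeparatesPoles M N (fun _ : Fin N => 0) (fun _ : Fin M => 0) c :=
    -- The point -1/2 lies between the poles -1, -2, … and 0, 1, … for all M and N.
    ⟨-(1 / 2), separatesPoles_zero_params_iff.2 ⟨fun _ => by norm_num, fun _ => by norm_num⟩⟩
  have hG : meijerG M N (fun _ : Fin N => 0) (fun _ : Fin M => 0) x = g := by
    rw [meijerG, dif_pos hex]
    exact hline _ hex.choose_spec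
  refine ⟨⟨hex, fun c hc => ⟨?_, by rw [hline c hc, hG]⟩⟩, hG⟩
  obtain ⟨hM, hN⟩ := separatesPoles_zero_params_iff.1 hc
  exact integrable_meijerIntegrand_zero_params hMN hx hM hN

/-! ### Moments of the quotient and the density formula -/

theorem abs_quotient_cpow {Ω : Type*} {M N : ℕ} (X : Fin M → Ω → ℝ) (Y : Fin N → Ω → ℝ) (w : ℂ)
    (ω : Ω) :
    ((|(∏ i, X i ω) / ∏ j, Y j ω| : ℝ) : ℂ) ^ (w - 1) =
      ∏ i, ((|Sum.elim X Y i ω| : ℝ) : ℂ) ^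
        (Sum.elim (fun _ => w - 1) (fun _ => 1 - w) i : ℂ) := by
  rw [abs_div, Finset.abs_prod, Finset.abs_prod,
    ofReal_prod_div_prod_cpow (fun _ => abs_nonneg _) (fun _ => abs_nonneg _),
    Fintype.prod_sum_type, neg_sub]
  simp only [Sum.elim_inl, Sum.elim_inr]

theorem integral_abs_quotient_cpow {Ω : Type*} [MeasurableSpace Ω] {P : Measure Ω} {M N : ℕ}
    {X : Fin M → Ω → ℝ} {Y : Fin N → Ω → ℝ} {σX : Fin M → ℝ} {σY : Fin N → ℝ}
    (hσX : ∀ i, 0 < σX i) (hσY : ∀ j, 0 < σY j)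
    (hX : ∀ i, HasLaw (X i) (gaussianReal 0 (σX i ^ 2).toNNReal) P)
    (hY : ∀ j, HasLaw (Y j) (gaussianReal 0 (σY j ^ 2).toNNReal) P)
    (hind : iIndepFun (Sum.elim X Y) P) {v : ℂ} (hM : M ≠ 0 → 0 < v.re) (hN : N ≠ 0 → v.re < 1) :
    Integrable (fun ω => ((|(∏ i, X i ω) / ∏ j, Y j ω| : ℝ) : ℂ) ^ (2 * v - 1)) P ∧
      ∫ ω, ((|(∏ i, X i ω) / ∏ j, Y j ω| : ℝ) : ℂ) ^ (2 * v - 1) ∂P =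
        ((√Real.pi)⁻¹ ^ (M + N) : ℝ) *
          (((∏ i, √2 * σX i) / ∏ j, √2 * σY j : ℝ) : ℂ) ^ (2 * v - 1) * gammaProd M N v := by
  have hσ : ∀ i, 0 < Sum.elim σX σY i := by
    rintro (i | j)
    · exact hσX i
    · exact hσY j
  have hU : ∀ i, HasLaw (Sum.elim X Y i)
      (gaussianReal 0 (Sum.elim σX σY i ^ 2).toNNReal) P := by
    rintro (i | j)
    · exact hX i
    · exact hY j
  have hr : ∀ i : Fin M ⊕ Fin N,
      -1 < (Sum.elim (fun _ => 2 * v - 1) (fun _ => 1 - 2 * v) i : ℂ).re := by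
    rintro (i | j)
    · have := hM (by rintro rfl; exact i.elim0)
      simpa using this
    · have := hN (by rintro rfl; exact j.elim0)
      simp
      linarith
  simp only [abs_quotient_cpow]
  refine ⟨integrable_prod_abs_cpow hσ hU hind hr, ?_⟩
  rw [integral_prod_abs_cpow hσ hU hind hr, Fintype.prod_sum_type,
    ofReal_prod_div_prod_cpow (fun i => by have := hσX i; positivity)
      (fun j => by have := hσY j; positivity)]
  simp only [Sum.elim_inl, Sum.elim_inr, Finset.prod_mul_distrib, Finset.prod_const,
    Finset.card_univ, Fintype.card_fin, gammaProd, neg_sub]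
  -- The choice w = 2v makes the Gamma arguments (r+1)/2 equal to v for numerators and 1 - v for
  -- denominators.
  rw [show (2 * v - 1 + 1) / 2 = v by ring, show (1 - 2 * v + 1) / 2 = 1 - v by ring]
  push_cast
  ring

theorem two_rpow_half_sub (M N : ℕ) : (2 : ℝ) ^ (((N : ℝ) - M) / 2) = √2 ^ N / √2 ^ M := by
  rw [sub_div, Real.rpow_sub two_pos, Real.sqrt_eq_rpow, ← Real.rpow_mul_natCast zero_le_two,
    ← Real.rpow_mul_natCast zero_le_two]
  congr 2 <;> ring

theorem pi_rpow_half_add (M N : ℕ) : Real.pi ^ (((M : ℝ) + N) / 2) = √Real.pi ^ (M + N) := by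
  rw [Real.sqrt_eq_rpow, ← Real.rpow_mul_natCast Real.pi_pos.le]
  push_cast
  congr 1
  ring

theorem theorem2p1 {Ω : Type*} [MeasurableSpace Ω] (P : Measure Ω) [IsProbabilityMeasure P]
    (M N : ℕ) (hMN : 1 ≤ M + N)
    (X : Fin M → Ω → ℝ) (Y : Fin N → Ω → ℝ)
    (σX : Fin M → ℝ) (σY : Fin N → ℝ)
    (hσX : ∀ i, 0 < σX i) (hσY : ∀ j, 0 < σY j)
    (hX : ∀ i, HasLaw (X i) (gaussianReal 0 (σX i ^ 2).toNNReal) P)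
    (hY : ∀ j, HasLaw (Y j) (gaussianReal 0 (σY j ^ 2).toNNReal) P)
    (hind : iIndepFun (Sum.elim X Y) P) :
    ∃ f : ℝ → ℝ≥0∞, Continuous f ∧
      HasLaw (fun ω => (∏ i, X i ω) / ∏ j, Y j ω) (volume.withDensity f) P ∧
      ∀ z : ℝ, z ≠ 0 →
        MeijerGWellDefined M N (fun _ : Fin N => 0) (fun _ : Fin M => 0)
          (2 ^ N * (∏ j, σY j) ^ 2 / (2 ^ M * (∏ i, σX i) ^ 2) * z ^ 2) ∧
        f z ≠ ∞ ∧
        ((f z).toReal : ℂ) =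
          (((2 : ℝ) ^ (((N : ℝ) - M) / 2) * (∏ j, σY j) /
              (Real.pi ^ (((M : ℝ) + N) / 2) * ∏ i, σX i) : ℝ) : ℂ) *
            meijerG M N (fun _ : Fin N => 0) (fun _ : Fin M => 0)
              (2 ^ N * (∏ j, σY j) ^ 2 / (2 ^ M * (∏ i, σX i) ^ 2) * z ^ 2) := by
  obtain ⟨f, hf, hlaw, heven, hfin⟩ := exists_even_continuous_density hMN hσX hσY hX hY hind
  refine ⟨f, hf, hlaw, fun z hz => ?_⟩
  set A : ℝ := (∏ i, √2 * σX i) / ∏ j, √2 * σY j with hA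
  have hpX : 0 < ∏ i, σX i := Finset.prod_pos fun i _ => hσX i
  have hpY : 0 < ∏ j, σY j := Finset.prod_pos fun j _ => hσY j
  have hA' : A = (√2 ^ M * ∏ i, σX i) / (√2 ^ N * ∏ j, σY j) := by
    simp [hA, Finset.prod_mul_distrib]
  have hA0 : 0 < A := by rw [hA']; positivity
  have hz' : 0 < |z| := abs_pos.2 hz
  have habs : f |z| = f z := by
    rcases abs_choice z with h | h <;> rw [h]
    exact heven z
  have hx : 2 ^ N * (∏ j, σY j) ^ 2 / (2 ^ M * (∏ i, σX i) ^ 2) * z ^ 2 = (|z| / A) ^ 2 := by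
    rw [hA', div_pow, sq_abs, div_pow, mul_pow, mul_pow, ← pow_mul, ← pow_mul, mul_comm M,
      mul_comm N, pow_mul, pow_mul, Real.sq_sqrt zero_le_two]
    field_simp
  have hC : (2 : ℝ) ^ (((N : ℝ) - M) / 2) * (∏ j, σY j) /
      (Real.pi ^ (((M : ℝ) + N) / 2) * ∏ i, σX i) = (√Real.pi)⁻¹ ^ (M + N) / A := by
    rw [two_rpow_half_sub, pi_rpow_half_add, hA', inv_pow]
    field_simp
  have hcont : ContinuousAt (fun z => ((f z).toReal : ℂ)) |z| :=
    Complex.continuous_ofReal.continuousAt.comp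
      ((ENNReal.tendsto_toReal (hfin _ hz'.ne')).comp hf.continuousAt)
  have hmellin {v : ℂ} (hM : M ≠ 0 → 0 < v.re) (hN : N ≠ 0 → v.re < 1) :=
    integral_abs_quotient_cpow hσX hσY hX hY hind hM hN
  rw [hx, hC]
  set C : ℝ := (√Real.pi)⁻¹ ^ (M + N) / A with hCdef
  have hC0 : (C : ℂ) ≠ 0 := by
    have : 0 < C := by positivity
    exact_mod_cast this.ne'
  -- The common value is f(z)/C, which does not involve c; evenness replaces z by |z| so that
  -- inversion applies.
  have key := meijerGWellDefined_of_lineIntegral_eq hMN (x := (|z| / A) ^ 2) (by positivity)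
    (g := ((f z).toReal : ℂ) / C) fun c hM hN => by
      rw [div_eq_iff hC0, ← habs, mul_comm, hCdef, Complex.ofReal_div]
      have h0 := mellin_even_density hf.measurable hlaw heven hfin
        (hmellin (v := c) (by simpa using hM) (by simpa using hN)).1
      have h := mellin_inversion_scaled (F := fun z => ((f z).toReal : ℂ)) (c := c)
        (G := gammaProd M N) (K := (((√Real.pi)⁻¹ ^ (M + N) : ℝ) : ℂ)) hA0 (by simpa using h0.1)
        (fun t => by
          have hm := hmellin (v := c + t * Complex.I) (by simpa using hM) (by simpa using hN)
          rw [(mellin_even_density hf.measurable hlaw heven hfin hm.1).2, hm.2]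
          ring)
        (integrable_gammaProd_line hMN hM hN) hz' hcont
      simpa using h
  refine ⟨key.1, hfin z hz, ?_⟩
  rw [key.2]
  field_simp
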